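/- Let $X$ be a $\sigma$-compact metrizable Suslin space without isolated points, where a Suslin space is a continuous image of a Polish space. Let $Y$ be a Fréchet space, that is, a locally convex topological vector space whose topology is induced by a complete translation-invariant metric. A function $f:X\to Y$ is Baire-1 if it is the pointwise limit of a sequence of continuous functions $X\to Y$, and Baire-2 if it is the pointwise limit of a sequence of Baire-1 functions. For $f:X\to Y$ let $L_f\subseteq X\times Y$ denote the set of accumulation points in $X\times Y$ of the graph $\{(x,f(x)) : x\in X\}$. Let $T\subseteq X\times Y$. (1) If $Y$ is compact, then there exists a Baire-2 function $f:X\to Y$ with $L_f=T$ if and only if $T$ is closed in $X\times Y$ and $T\cap(\{x\}\times Y)\neq\emptyset$ for every $x\in X$. (2) If $Y$ is $\sigma$-compact but not compact, then there exists a Baire-2 function $f:X\to Y$ with $L_f=T$ if and only if $T$ is closed in $X\times Y$ and there is a countable set $D\subseteq X$ such that $T\cap(\{x\}\times Y)\neq\emptyset$ for every $x\in X\setminus D$. -/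

import Mathlib

open Set Filter Topology

/-- `X` is a Suslin space: a continuous image of a Polish space. Mathlib's `AnalyticSet` says this
about a subset, here the whole space. Metrizability is not included and is
assumed separately. -/
class SuslinSpace (X : Type*) [TopologicalSpace X] : Prop where
  analyticSet_univ : MeasureTheory.AnalyticSet (univ : Set X)

/-- `Y` is a (real) Fréchet space: a locally convex topological vector space whose topology is
induced by some complete translation invariant metric. A complex Fréchet space is in particular
a real one. -/
class FrechetSpace (Y : Type*) [AddCommGroup Y] [Module ℝ Y] [t : TopologicalSpace Y] : Prop
    extends IsTopologicalAddGroup Y, ContinuousSMul ℝ Y, LocallyConvexSpace ℝ Y where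
  exists_metric : ∃ m : MetricSpace Y,
    m.toUniformSpace.toTopologicalSpace = t ∧
    (∀ x y z : Y, m.dist (x + z) (y + z) = m.dist x y) ∧
    @CompleteSpace Y m.toUniformSpace

/-- `IsBaire n f`: the function `f` is Baire-`n`, for a finite `n`. Baire-`0` functions are the
continuous ones, and Baire-`(n + 1)` functions are the pointwise limits of sequences of
Baire-`n` functions. -/
def IsBaire {X Y : Type*} [TopologicalSpace X] [TopologicalSpace Y] : ℕ → (X → Y) → Prop
  | 0, f => Continuous f
  | n + 1, f => ∃ g : ℕ → X → Y, (∀ k, IsBaire n (g k)) ∧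
      ∀ x, Tendsto (fun k => g k x) atTop (𝓝 (f x))

/-- The set `L_f` of the accumulation points, in `X × Y`, of the graph of `f`. -/
def graphAccSet {X Y : Type*} [TopologicalSpace X] [TopologicalSpace Y] (f : X → Y) :
    Set (X × Y) :=
  derivedSet (univ.graphOn f)

/-! A compact Hausdorff real topological vector space is a point, so case (1) degenerates: as `X` is
perfect, every graph accumulates everywhere. In case (2), Baire category makes `Y` locally compact.

Necessity: points with empty fibre at which `f` takes values in one fixed compact set form a
discrete set, since values near an accumulation point would cluster; discrete sets in `X` are
countable (`countable_setOf_fibre_graphAccSet_eq_empty`).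

Sufficiency: take a Baire-2 selection of `T` (`exists_isBaire_two_selection`). Redefine it on a
countable set so that its graph clusters at a dense part of `T` and nowhere off `T`
(`exists_countable_partial_graph`), and let the values over the countably many empty fibres escape
to infinity. Countable changes preserve Baire-2 (`IsBaire.modify_countable`). -/

theorem isBaire_const {X Y : Type*} [TopologicalSpace X] [TopologicalSpace Y] (n : ℕ) (y : Y) :
    IsBaire n (fun _ : X => y) := by
  induction n with
  | zero => exact continuous_const
  | succ n ih => exact ⟨fun _ _ => y, fun _ => ih, fun _ => tendsto_const_nhds⟩

theorem IsBaire.add {X Y : Type*} [TopologicalSpace X] [TopologicalSpace Y] [Add Y]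
    [ContinuousAdd Y] {n : ℕ} {f g : X → Y} (hf : IsBaire n f) (hg : IsBaire n g) :
    IsBaire n (fun x => f x + g x) := by
  induction n generalizing f g with
  | zero => exact Continuous.add hf hg
  | succ n ih =>
    obtain ⟨u, hu, hu'⟩ := hf
    obtain ⟨v, hv, hv'⟩ := hg
    exact ⟨fun k x => u k x + v k x, fun k => ih (hu k) (hv k), fun x => (hu' x).add (hv' x)⟩

theorem IsBaire.smul {X Y R : Type*} [TopologicalSpace X] [TopologicalSpace Y]
    [TopologicalSpace R] [SMul R Y] [ContinuousSMul R Y] {n : ℕ} {c : X → R} {f : X → Y}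
    (hc : IsBaire n c) (hf : IsBaire n f) : IsBaire n (fun x => c x • f x) := by
  induction n generalizing c f with
  | zero => exact Continuous.smul hc hf
  | succ n ih =>
    obtain ⟨u, hu, hu'⟩ := hc
    obtain ⟨v, hv, hv'⟩ := hf
    exact ⟨fun k x => u k x • v k x, fun k => ih (hu k) (hv k), fun x => (hu' x).smul (hv' x)⟩

/-! ### Gluing along closed sets and changes on countable sets -/

section Piecewise

variable {X : Type*} [TopologicalSpace X] [TopologicalSpace.MetrizableSpace X]

open scoped Classical in
theorem IsClosed.isBaire_ite {F : Set X} (hF : IsClosed F) (a b : ℝ) :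
    IsBaire 1 (fun x => if x ∈ F then a else b) := by
  let := TopologicalSpace.metrizableSpaceMetric X
  refine ⟨fun n x => (hF.apprSeq n x : ℝ) * (a - b) + b, fun n => ?_, fun x => ?_⟩
  · exact ((NNReal.continuous_coe.comp (hF.apprSeq n).continuous).mul continuous_const).add
      continuous_const
  · have h := tendsto_pi_nhds.1 (HasOuterApproxClosed.tendsto_apprSeq hF) x
    have h2 := (((NNReal.continuous_coe.tendsto _).comp h).mul_const (a - b)).add_const b
    convert! h2 using 2
    by_cases hx : x ∈ F <;> simp [hx]

variable {Y : Type*} [AddCommGroup Y] [Module ℝ Y] [TopologicalSpace Y] [ContinuousAdd Y]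
  [ContinuousSMul ℝ Y]

open scoped Classical in
theorem IsBaire.ite_isClosed {F : Set X} (hF : IsClosed F) {f g : X → Y} (hf : IsBaire 1 f)
    (hg : IsBaire 1 g) : IsBaire 1 (fun x => if x ∈ F then f x else g x) := by
  convert! ((hF.isBaire_ite 1 0).smul hf).add ((hF.isBaire_ite 0 1).smul hg) using 2 with x
  by_cases hx : x ∈ F <;> simp [hx]

open scoped Classical in
theorem IsBaire.modify_finset {g : X → Y} (hg : IsBaire 1 g) (h : X → Y) (s : Finset X) :
    IsBaire 1 (fun x => if x ∈ s then h x else g x) := by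
  induction s using Finset.induction_on with
  | empty => simpa using hg
  | insert a s _ ih =>
    convert! IsBaire.ite_isClosed (isClosed_singleton (x := a)) (isBaire_const 1 (h a)) ih
      using 2 with x
    by_cases hx : x = a <;> simp [hx]

/-- A Baire-`2` function may be redefined on a countable set. -/
theorem IsBaire.modify_countable {g h : X → Y} (hg : IsBaire 2 g) {C : Set X}
    (hC : C.Countable) (hgh : ∀ x ∉ C, h x = g x) : IsBaire 2 h := by
  classical
  rcases C.eq_empty_or_nonempty with rfl | hne
  · rwa [funext fun x => hgh x (by simp)]
  obtain ⟨c, rfl⟩ := hC.exists_eq_range hne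
  obtain ⟨u, hu, hu'⟩ := hg
  -- The `k`-th approximant is corrected only at the first `k` points of `C`, so it stays Baire-1,
  -- and each point of `C` is eventually corrected.
  refine ⟨fun k x => if x ∈ (Finset.range k).image c then h x else u k x,
    fun k => (hu k).modify_finset h _, fun x => ?_⟩
  by_cases hx : x ∈ range c
  · obtain ⟨m, rfl⟩ := hx
    refine tendsto_const_nhds.congr' ?_
    filter_upwards [eventually_gt_atTop m] with k hk
    rw [if_pos (Finset.mem_image_of_mem c (Finset.mem_range.2 hk))]
  · rw [hgh x hx]
    refine (hu' x).congr fun k => (if_neg fun hk => ?_).symm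
    obtain ⟨m, -, hm⟩ := Finset.mem_image.1 hk
    exact hx ⟨m, hm⟩

end Piecewise

/-! ### Baire-2 selection from a closed set -/

section Selection

/-- The points of `X` whose fibre in `T` meets `⋂ j ∈ J, C j`. -/
def fibreHits {X Y : Type*} (T : Set (X × Y)) (C : ℕ → Set Y) (J : Finset ℕ) : Set X :=
  {x | ∃ y, (x, y) ∈ T ∧ ∀ j ∈ J, y ∈ C j}

open scoped Classical in
/-- Run through the sets `C 0, …, C (k - 1)`, keeping the index of each set which meets what the
sets kept so far leave of the fibre of `T` over `x`. -/
noncomputable def greedyIndices {X Y : Type*} (T : Set (X × Y)) (C : ℕ → Set Y) (x : X) :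
    ℕ → Finset ℕ
  | 0 => ∅
  | k + 1 => if x ∈ fibreHits T C (insert k (greedyIndices T C x k))
      then insert k (greedyIndices T C x k) else greedyIndices T C x k

variable {X Y : Type*} {T : Set (X × Y)} {C : ℕ → Set Y}

theorem greedyIndices_mono (x : X) : Monotone (greedyIndices T C x) := by
  refine monotone_nat_of_le_succ fun k => ?_
  rw [greedyIndices]
  split_ifs
  · exact Finset.subset_insert _ _
  · exact le_rfl

theorem mem_fibreHits_greedyIndices {x : X} (hx : ∃ y, (x, y) ∈ T) (k : ℕ) :
    x ∈ fibreHits T C (greedyIndices T C x k) := by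
  induction k with
  | zero => simpa [greedyIndices, fibreHits] using hx
  | succ k ih =>
    rw [greedyIndices]
    split_ifs with h
    · exact h
    · exact ih

theorem mem_greedyIndices_succ {x : X} {y : Y} (hy : (x, y) ∈ T) {j : ℕ} (hj : y ∈ C j)
    (h : ∀ i ∈ greedyIndices T C x j, y ∈ C i) : j ∈ greedyIndices T C x (j + 1) := by
  rw [greedyIndices, if_pos]
  · exact Finset.mem_insert_self _ _
  · refine ⟨y, hy, fun i hi => ?_⟩
    rcases Finset.mem_insert.1 hi with rfl | hi
    · exact hj
    · exact h i hi

variable [TopologicalSpace X] [TopologicalSpace Y]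

/-- Projection along a compact factor is closed. For empty `J` there is no compact factor, and the
projection of `T` need not be closed. -/
theorem isClosed_fibreHits [T2Space Y] (hT : IsClosed T) (hC : ∀ j, IsCompact (C j))
    {J : Finset ℕ} (hJ : J.Nonempty) : IsClosed (fibreHits T C J) := by
  obtain ⟨i, hi⟩ := hJ
  have hK : IsCompact (⋂ j ∈ J, C j) :=
    (hC i).of_isClosed_subset (isClosed_biInter fun j _ => (hC j).isClosed)
      (biInter_subset_of_mem hi)
  have : CompactSpace (⋂ j ∈ J, C j : Set Y) := isCompact_iff_compactSpace.1 hK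
  have h := isClosedMap_fst_of_compactSpace (X := X) (Y := (⋂ j ∈ J, C j : Set Y)) _
    (hT.preimage (continuous_id.prodMap continuous_subtype_val))
  convert! h using 1
  ext x
  simp [fibreHits, and_comm]

/-- The fibres of `T` shrink to a point along the greedy choice. -/
theorem exists_forall_greedyIndices_mem [T2Space Y] (hT : IsClosed T)
    (hC : ∀ j, IsCompact (C j)) (hcover : ∀ y, ∃ j, y ∈ C j) {x : X}
    (hx : ∃ y, (x, y) ∈ T) :
    ∃ y, (x, y) ∈ T ∧ ∀ k, ∀ j ∈ greedyIndices T C x k, y ∈ C j := by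
  have hTx : IsClosed {y | (x, y) ∈ T} := hT.preimage (by fun_prop)
  -- Compactness is available only once some index has been kept, so the nested sets below start at
  -- such a stage `m`.
  obtain ⟨m, j, hjm⟩ : ∃ m, (greedyIndices T C x m).Nonempty := by
    obtain ⟨y, hy⟩ := hx
    obtain ⟨j, hj⟩ := hcover y
    by_cases he : (greedyIndices T C x j).Nonempty
    · exact ⟨j, he⟩
    · refine ⟨j + 1, j, mem_greedyIndices_succ hy hj fun i hi => ?_⟩
      exact absurd ⟨i, hi⟩ he
  let S : ℕ → Set Y := fun k =>
    {y | (x, y) ∈ T} ∩ ⋂ j ∈ greedyIndices T C x (m + k), C j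
  have hS : ∀ k, IsClosed (S k) := fun k =>
    hTx.inter (isClosed_biInter fun j _ => (hC j).isClosed)
  obtain ⟨y, hy⟩ := IsCompact.nonempty_iInter_of_sequence_nonempty_isCompact_isClosed S
    (fun k => inter_subset_inter_right _
      (biInter_subset_biInter_left (greedyIndices_mono x (by omega))))
    (fun k => by
      obtain ⟨y, hy, hy'⟩ := mem_fibreHits_greedyIndices (C := C) hx (m + k)
      exact ⟨y, hy, by simpa using hy'⟩)
    ((hC j).of_isClosed_subset (hS 0) (inter_subset_right.trans (biInter_subset_of_mem hjm))) hS
  rw [mem_iInter] at hy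
  refine ⟨y, (hy 0).1, fun k j hj => ?_⟩
  have := (hy k).2
  simp only [mem_iInter] at this
  exact this j (greedyIndices_mono x (by omega) hj)

end Selection

/-- Each greedy stage is one case split on a closed set. The induction absorbs the last split into
`φ`, which is why `φ` may depend on `x` as well as on `J`. -/
theorem IsBaire.greedyIndices_comp {X Y : Type*} [TopologicalSpace X]
    [TopologicalSpace.MetrizableSpace X] [AddCommGroup Y] [Module ℝ Y] [TopologicalSpace Y]
    [ContinuousAdd Y] [ContinuousSMul ℝ Y] [T2Space Y] {T : Set (X × Y)} {C : ℕ → Set Y}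
    (hT : IsClosed T) (hC : ∀ j, IsCompact (C j)) (k : ℕ) {φ : Finset ℕ → X → Y}
    (hφ : ∀ J, IsBaire 1 (φ J)) : IsBaire 1 (fun x => φ (greedyIndices T C x k) x) := by
  classical
  induction k generalizing φ with
  | zero => exact hφ ∅
  | succ k ih =>
    have h : ∀ J, IsBaire 1
        (fun x => if x ∈ fibreHits T C (insert k J) then φ (insert k J) x else φ J x) := fun J =>
      (hφ _).ite_isClosed (isClosed_fibreHits hT hC (Finset.insert_nonempty _ _)) (hφ _)
    convert! ih h using 2 with x
    rw [greedyIndices]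
    split_ifs <;> rfl

/-- Closures of basic open sets are cut by a compact covering; regularity fits them inside
neighbourhoods. -/
theorem exists_compact_network (Y : Type*) [TopologicalSpace Y] [SecondCountableTopology Y]
    [SigmaCompactSpace Y] [RegularSpace Y] :
    ∃ C : ℕ → Set Y, (∀ j, IsCompact (C j)) ∧ ∀ y, ∀ U ∈ 𝓝 y, ∃ j, y ∈ C j ∧ C j ⊆ U := by
  let B := TopologicalSpace.countableBasis Y
  let D : Set (Set Y) := insert ∅ (image2 (fun n b => compactCovering Y n ∩ closure b) univ B)
  have hD : D.Countable :=
    (countable_univ.image2 (TopologicalSpace.countable_countableBasis Y) _).insert _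
  obtain ⟨C, hC⟩ := hD.exists_eq_range (insert_nonempty _ _)
  refine ⟨C, fun j => ?_, fun y U hU => ?_⟩
  · have hj : C j ∈ D := hC ▸ mem_range_self j
    rcases hj with hj | ⟨n, -, b, -, hj⟩
    · rw [hj]; exact isCompact_empty
    · rw [← hj]; exact (isCompact_compactCovering Y n).inter_right isClosed_closure
  · obtain ⟨b, hbB, hyb, hbU⟩ :=
      (TopologicalSpace.isBasis_countableBasis Y).exists_closure_subset hU
    obtain ⟨n, hn⟩ := exists_mem_compactCovering y
    obtain ⟨j, hj⟩ : compactCovering Y n ∩ closure b ∈ range C :=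
      hC ▸ Or.inr ⟨n, mem_univ _, b, hbB, rfl⟩
    exact ⟨j, hj ▸ ⟨hn, subset_closure hyb⟩, hj ▸ inter_subset_right.trans hbU⟩

theorem exists_isBaire_two_selection {X Y : Type*} [TopologicalSpace X]
    [TopologicalSpace.MetrizableSpace X] [AddCommGroup Y] [Module ℝ Y] [TopologicalSpace Y]
    [ContinuousAdd Y] [ContinuousSMul ℝ Y] [T3Space Y] [SecondCountableTopology Y]
    [SigmaCompactSpace Y] {T : Set (X × Y)} (hT : IsClosed T) :
    ∃ g : X → Y, IsBaire 2 g ∧ ∀ x, (∃ y, (x, y) ∈ T) → (x, g x) ∈ T := by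
  obtain ⟨C, hC, hnet⟩ := exists_compact_network Y
  -- The representative depends on `J` alone and need not lie in a fibre of `T`; only the limit has
  -- to.
  have hsel : ∀ J : Finset ℕ, ∃ z : Y, (∃ y, ∀ j ∈ J, y ∈ C j) → ∀ j ∈ J, z ∈ C j := fun J => by
    by_cases h : ∃ y, ∀ j ∈ J, y ∈ C j
    · exact ⟨h.choose, fun _ => h.choose_spec⟩
    · exact ⟨0, fun h' => absurd h' h⟩
  choose φ hφ using hsel
  have hlim : ∀ x, ∃ y, Tendsto (fun k => φ (greedyIndices T C x k)) atTop (𝓝 y) ∧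
      ((∃ y, (x, y) ∈ T) → (x, y) ∈ T) := fun x => by
    by_cases hx : ∃ y, (x, y) ∈ T
    · obtain ⟨y, hy, hyC⟩ := exists_forall_greedyIndices_mem hT hC
        (fun y => (hnet y univ univ_mem).imp fun _ h => h.1) hx
      refine ⟨y, fun U hU => ?_, fun _ => hy⟩
      -- A network set around the surviving point `y` is always kept, and it traps all later
      -- representatives.
      obtain ⟨j, hyj, hjU⟩ := hnet y U hU
      have hj := mem_greedyIndices_succ hy hyj (hyC j)
      rw [mem_map]
      filter_upwards [eventually_ge_atTop (j + 1)] with k hk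
      exact hjU (hφ _ ⟨y, hyC k⟩ j (greedyIndices_mono x hk hj))
    · refine ⟨φ ∅, ?_, fun h => absurd h hx⟩
      have : ∀ k, greedyIndices T C x k = ∅ := fun k => by
        induction k with
        | zero => rfl
        | succ k ih =>
          rw [greedyIndices, if_neg, ih]
          rintro ⟨y, hy, -⟩
          exact hx ⟨y, hy⟩
      simp [this]
  choose g hg hgT using hlim
  exact ⟨g, ⟨fun k x => φ (greedyIndices T C x k), fun k =>
    IsBaire.greedyIndices_comp hT hC k (φ := fun J _ => φ J) fun J => isBaire_const 1 _, hg⟩, hgT⟩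

/-! ### Accumulation points of graphs and necessity -/

theorem mem_graphAccSet_of_forall {X Y : Type*} [TopologicalSpace X] [TopologicalSpace Y]
    {f : X → Y} {x : X} {y : Y}
    (h : ∀ U ∈ 𝓝 x, ∀ V ∈ 𝓝 y, ∃ z ∈ U, z ≠ x ∧ f z ∈ V) : (x, y) ∈ graphAccSet f := by
  refine accPt_iff_nhds.2 fun W hW => ?_
  obtain ⟨U, hU, V, hV, hUV⟩ := mem_nhds_prod_iff.1 hW
  obtain ⟨z, hzU, hzx, hzV⟩ := h U hU V hV
  exact ⟨(z, f z), ⟨hUV ⟨hzU, hzV⟩, z, mem_univ z, rfl⟩, fun he => hzx (congrArg Prod.fst he)⟩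

theorem isClosed_graphAccSet {X Y : Type*} [TopologicalSpace X] [TopologicalSpace Y]
    [T1Space X] [T1Space Y] (f : X → Y) : IsClosed (graphAccSet f) :=
  isClosed_derivedSet _

theorem countable_setOf_fibre_graphAccSet_eq_empty {X Y : Type*} [TopologicalSpace X]
    [SecondCountableTopology X] [TopologicalSpace Y] [SigmaCompactSpace Y] (f : X → Y) :
    {x | ∀ y, (x, y) ∉ graphAccSet f}.Countable := by
  let D : ℕ → Set X := fun n =>
    {x | (∀ y, (x, y) ∉ graphAccSet f) ∧ f x ∈ compactCovering Y n}
  have hD : ∀ n, (D n).Countable := fun n => by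
    have : DiscreteTopology (D n) := discreteTopology_of_noAccPts fun x hx hacc => by
      have hne : (𝓝[≠] x ⊓ 𝓟 (D n)).NeBot := hacc
      obtain ⟨y, -, hy⟩ := (isCompact_compactCovering Y n).exists_mapClusterPt
        (f := 𝓝[≠] x ⊓ 𝓟 (D n)) (u := f)
        (le_principal_iff.2 (mem_map.2 (mem_inf_of_right fun z hz => hz.2)))
      refine hx.1 y (mem_graphAccSet_of_forall fun U hU V hV => ?_)
      have hev : ∀ᶠ z in 𝓝[≠] x ⊓ 𝓟 (D n), z ∈ U ∧ z ≠ x :=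
        mem_inf_of_left (inter_mem (mem_nhdsWithin_of_mem_nhds hU) self_mem_nhdsWithin)
      obtain ⟨z, hz, hzU, hzx⟩ := ((hy.frequently hV).and_eventually hev).exists
      exact ⟨z, hzU, hzx, hz⟩
    exact countable_coe_iff.1 (countable_of_Lindelof_of_discrete (X := D n))
  refine (countable_iUnion hD).mono fun x hx => ?_
  obtain ⟨n, hn⟩ := exists_mem_compactCovering (f x)
  exact mem_iUnion.2 ⟨n, hx, hn⟩

/-! ### Construction of a graph with prescribed accumulation set -/

theorem exists_injective_forall_mem_of_infinite {X : Type*} {A : ℕ → Set X}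
    (hA : ∀ n, (A n).Infinite) : ∃ e : ℕ → X, Function.Injective e ∧ ∀ n, e n ∈ A n := by
  classical
  choose p hpA hps using fun n (s : Finset X) => (hA n).exists_notMem_finset s
  let S : ℕ → Finset X := Nat.rec ∅ fun n s => insert (p n s) s
  have hS : Monotone S := monotone_nat_of_le_succ fun n => Finset.subset_insert _ _
  have hlt : ∀ m n, m < n → p m (S m) ≠ p n (S n) := fun m n hmn he =>
    hps n (S n) (he ▸ hS (Nat.succ_le_of_lt hmn) (Finset.mem_insert_self _ _))
  refine ⟨fun n => p n (S n), fun m n he => ?_, fun n => hpA _ _⟩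
  rcases lt_trichotomy m n with h | h | h
  · exact absurd he (hlt m n h)
  · exact h
  · exact absurd he.symm (hlt n m h)

theorem not_accPt_of_finite_inter {Z : Type*} [TopologicalSpace Z] [T1Space Z] {z : Z}
    {A N : Set Z} (hN : N ∈ 𝓝 z) (h : (N ∩ A).Finite) : ¬ AccPt z (𝓟 A) := fun hacc =>
  (Set.Infinite.of_accPt (hacc.nhds_inter hN)) h

/-- If the points `(e n, (a n).2)` approach points `a n` of `T`, then only finitely many of them lie
in a box which stays away from `T`. -/
theorem finite_setOf_mem_ball_prod {X Y : Type*} [PseudoMetricSpace X]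
    {T : Set (X × Y)} {x : X} {r : ℝ} (hr : 0 < r) {V : Set Y}
    (hT : Disjoint (Metric.ball x r ×ˢ V) T) {a : ℕ → X × Y} (ha : ∀ n, a n ∈ T) {e : ℕ → X}
    (he : ∀ n, dist (e n) (a n).1 < 1 / ((n : ℝ) + 1)) :
    {n | (e n, (a n).2) ∈ Metric.ball x (r / 2) ×ˢ V}.Finite := by
  obtain ⟨m, hm⟩ := exists_nat_one_div_lt (half_pos hr)
  refine (finite_lt_nat m).subset fun n hn => ?_
  by_contra! hmn
  replace hmn : m ≤ n := not_lt.1 hmn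
  refine Set.disjoint_left.1 hT (show a n ∈ _ from ⟨?_, hn.2⟩) (ha n)
  have h1 : dist (e n) x < r / 2 := hn.1
  have h2 : dist (e n) (a n).1 < r / 2 :=
    (he n).trans_le ((one_div_le_one_div_of_le (by positivity) (by gcongr)).trans hm.le)
  have h3 := dist_triangle_left (a n).1 x (e n)
  exact Metric.mem_ball.2 (by linarith)

/-- The graph of `f` accumulates only at `T` when the graph lies in `T` up to
a set `E` which is locally finite away from `T` and countably many points which leave every
compact set. -/
theorem graphAccSet_subset_of_cover {X Y : Type*} [MetricSpace X] [TopologicalSpace Y] [T1Space Y]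
    {T : Set (X × Y)} (hT : IsClosed T) (K : CompactExhaustion Y) {f : X → Y} {E : Set (X × Y)}
    (hE : ∀ (x : X) (r : ℝ) (V : Set Y), 0 < r → Disjoint (Metric.ball x r ×ˢ V) T →
      ((Metric.ball x (r / 2) ×ˢ V) ∩ E).Finite)
    {D : Set X} {ι : X → ℕ} (hι : InjOn ι D) (hD : ∀ x ∈ D, f x ∉ K (ι x))
    (hf : ∀ x, (x, f x) ∈ T ∨ (x, f x) ∈ E ∨ x ∈ D) : graphAccSet f ⊆ T := by
  rintro ⟨x, y⟩ hxy
  by_contra hxyT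
  obtain ⟨U, hU, V, hV, hUV⟩ := mem_nhds_prod_iff.1 (hT.isOpen_compl.mem_nhds hxyT)
  obtain ⟨r, hr, hrU⟩ := Metric.mem_nhds_iff.1 hU
  obtain ⟨n, hn⟩ := K.exists_mem_nhds y
  have hdisj : Disjoint (Metric.ball x r ×ˢ V) T :=
    Set.disjoint_left.2 fun p hp => hUV ⟨hrU hp.1, hp.2⟩
  refine not_accPt_of_finite_inter
    (N := Metric.ball x (r / 2) ×ˢ (V ∩ K n)) (prod_mem_nhds (Metric.ball_mem_nhds _ (by linarith))
      (inter_mem hV hn)) ?_ hxy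
  -- Points of `D` with `ι x ≥ n` have values outside `K n`, so only these can enter the box.
  have hfin : (D ∩ {x | ι x < n}).Finite :=
    Set.Finite.of_finite_image ((finite_lt_nat n).subset (by rintro _ ⟨x, hx, rfl⟩; exact hx.2))
      (hι.mono inter_subset_left)
  refine ((hE x r V hr hdisj).union (hfin.image fun x => (x, f x))).subset ?_
  rintro _ ⟨⟨hzx, hzV, hzK⟩, z, -, rfl⟩
  rcases hf z with h | h | h
  · exact absurd h (Set.disjoint_left.1 hdisj ⟨Metric.ball_subset_ball (by linarith) hzx, hzV⟩)
  · exact Or.inl ⟨⟨hzx, hzV⟩, h⟩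
  · refine Or.inr ⟨z, ⟨h, ?_⟩, rfl⟩
    by_contra! hle
    exact hD z h (K.subset (not_lt.1 hle) hzK)

/-- There is a function on a countable subset of `X` whose graph is locally finite away from `T`
and accumulates at every point of a dense subset of `T`. -/
theorem exists_countable_partial_graph {X Y : Type*} [MetricSpace X] [PerfectSpace X]
    [SecondCountableTopology X] [TopologicalSpace Y] [SecondCountableTopology Y] [Nonempty Y]
    (T : Set (X × Y)) :
    ∃ (E : Set X) (b : X → Y), E.Countable ∧
      (∀ (x : X) (r : ℝ) (V : Set Y), 0 < r → Disjoint (Metric.ball x r ×ˢ V) T →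
        ((Metric.ball x (r / 2) ×ˢ V) ∩ E.graphOn b).Finite) ∧
      ∃ T₀ : Set (X × Y), T ⊆ closure T₀ ∧
        ∀ p ∈ T₀, ∀ U ∈ 𝓝 p.1, ∃ z ∈ U ∩ E, z ≠ p.1 ∧ b z = p.2 := by
  rcases T.eq_empty_or_nonempty with rfl | hne
  · exact ⟨∅, fun _ => Classical.arbitrary Y, countable_empty, fun x r V _ _ => by simp, ∅,
      empty_subset _, by simp⟩
  have : Nonempty T := hne.to_subtype
  let s : ℕ → X × Y := fun n => TopologicalSpace.denseSeq T n
  -- Unpairing repeats each `s m` infinitely often, hence with arbitrarily small radii `1 / (n +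
  -- 1)`.
  let a : ℕ → X × Y := fun n => s n.unpair.1
  have ha : ∀ n, a n ∈ T := fun n => Subtype.coe_prop _
  obtain ⟨e, he, hea⟩ := exists_injective_forall_mem_of_infinite
    (A := fun n => Metric.ball (a n).1 (1 / ((n : ℝ) + 1)) \ {(a n).1}) fun n =>
      (infinite_of_mem_nhds _ (Metric.ball_mem_nhds _ (by positivity))).sdiff (finite_singleton _)
  let b : X → Y := Function.extend e (fun n => (a n).2) fun _ => Classical.arbitrary Y
  have hb : ∀ n, b (e n) = (a n).2 := he.extend_apply _ _
  refine ⟨range e, b, countable_range e, fun x r V hr hV => ?_, range s, ?_, ?_⟩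
  · refine ((finite_setOf_mem_ball_prod hr hV ha fun n => (hea n).1).image
      fun n => (e n, b (e n))).subset ?_
    rintro _ ⟨hN, _, ⟨n, rfl⟩, rfl⟩
    exact ⟨n, by simpa only [mem_ofPred_eq, ← hb] using hN, rfl⟩
  · intro p hp
    have h := (TopologicalSpace.denseRange_denseSeq T) ⟨p, hp⟩
    rw [closure_subtype, ← range_comp] at h
    exact h
  · rintro _ ⟨m, rfl⟩ U hU
    obtain ⟨r, hr, hrU⟩ := Metric.mem_nhds_iff.1 hU
    obtain ⟨k, hk⟩ := exists_nat_one_div_lt hr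
    have hn : a (Nat.pair m k) = s m := by simp only [a, Nat.unpair_pair]
    have hkn : k ≤ Nat.pair m k := Nat.right_le_pair m k
    have hen := hea (Nat.pair m k)
    rw [hn] at hen
    refine ⟨e (Nat.pair m k), ⟨hrU ?_, mem_range_self _⟩, hen.2, by rw [hb, hn]⟩
    exact Metric.ball_subset_ball
      ((one_div_le_one_div_of_le (by positivity) (by gcongr)).trans hk.le) hen.1

/-- Sufficiency: every closed set with enough nonempty fibres is the accumulation set of the graph
of a Baire-`2` function. -/
theorem exists_isBaire_two_graphAccSet_eq {X Y : Type*} [TopologicalSpace X]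
    [TopologicalSpace.MetrizableSpace X] [SecondCountableTopology X] [PerfectSpace X]
    [AddCommGroup Y] [Module ℝ Y] [TopologicalSpace Y] [ContinuousAdd Y] [ContinuousSMul ℝ Y]
    [T3Space Y] [SecondCountableTopology Y] [SigmaCompactSpace Y] [WeaklyLocallyCompactSpace Y]
    [NoncompactSpace Y] {T : Set (X × Y)} (hT : IsClosed T)
    (hD : {x | ∀ y, (x, y) ∉ T}.Countable) : ∃ f : X → Y, IsBaire 2 f ∧ graphAccSet f = T := by
  classical
  let := TopologicalSpace.metrizableSpaceMetric X
  obtain ⟨g, hg, hgT⟩ := exists_isBaire_two_selection hT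
  obtain ⟨E, b, hE, hEfin, T₀, hT₀, hacc⟩ := exists_countable_partial_graph T
  obtain ⟨ι, hι⟩ := countable_iff_exists_injOn.1 hD
  let K : CompactExhaustion Y := default
  choose q hq using fun n => (ne_univ_iff_exists_notMem _).1 (K.isCompact n).ne_univ
  let f : X → Y := fun x => if x ∈ E then b x else if ∃ y, (x, y) ∈ T then g x else q (ι x)
  have hfE : ∀ x ∈ E, f x = b x := fun x hx => if_pos hx
  refine ⟨f, hg.modify_countable (hE.union hD) fun x hx => ?_, Subset.antisymm ?_ ?_⟩
  · have h1 : x ∉ E := fun h => hx (Or.inl h)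
    have h2 : ∃ y, (x, y) ∈ T := by
      by_contra! h
      exact hx (Or.inr h)
    simp only [f, if_neg h1, if_pos h2]
  · refine graphAccSet_subset_of_cover hT K hEfin
      (D := {x | ∀ y, (x, y) ∉ T} \ E) (hι.mono sdiff_subset) (fun x hx => ?_) fun x => ?_
    · have h : ¬ ∃ y, (x, y) ∈ T := not_exists.2 hx.1
      simpa only [f, if_neg hx.2, if_neg h] using hq (ι x)
    · by_cases hxE : x ∈ E
      · exact Or.inr (Or.inl ⟨x, hxE, by rw [hfE x hxE]⟩)
      · by_cases hx : ∃ y, (x, y) ∈ T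
        · left
          simpa only [f, if_neg hxE, if_pos hx] using hgT x hx
        · exact Or.inr (Or.inr ⟨not_exists.1 hx, hxE⟩)
  · refine hT₀.trans (closure_minimal (fun p hp => ?_) (isClosed_graphAccSet f))
    refine mem_graphAccSet_of_forall (x := p.1) (y := p.2) fun U hU V hV => ?_
    obtain ⟨z, ⟨hzU, hzE⟩, hzp, hz⟩ := hacc p hp U hU
    exact ⟨z, hzU, hzp, by rw [hfE z hzE, hz]; exact mem_of_mem_nhds hV⟩

/-! ### Compactness in Fréchet spaces and the main theorem -/

theorem FrechetSpace.isCompletelyMetrizableSpace (Y : Type*) [AddCommGroup Y] [Module ℝ Y]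
    [TopologicalSpace Y] [FrechetSpace Y] :
    TopologicalSpace.IsCompletelyMetrizableSpace Y :=
  let ⟨m, hm, _, hc⟩ := FrechetSpace.exists_metric (Y := Y)
  ⟨m, hm, hc⟩

/-- By Baire category some compact set of a countable cover has interior; translation spreads it. -/
theorem locallyCompactSpace_of_sigmaCompactSpace_of_baireSpace (G : Type*) [TopologicalSpace G]
    [AddGroup G] [IsTopologicalAddGroup G] [SigmaCompactSpace G] [BaireSpace G] [T2Space G] :
    LocallyCompactSpace G := by
  obtain ⟨n, x, hx⟩ := nonempty_interior_of_iUnion_of_closed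
    (fun n => (isCompact_compactCovering G n).isClosed) (iUnion_compactCovering G)
  exact (isCompact_compactCovering G n).locallyCompactSpace_of_mem_nhds_of_addGroup
    (mem_interior_iff_mem_nhds.1 hx)

/-- A compact space is bounded, so scaling `(n + 1) • y` by `1 / (n + 1)` must tend to `0`; but it
is constantly `y`. -/
theorem subsingleton_of_compactSpace (E : Type*) [AddCommGroup E] [Module ℝ E]
    [TopologicalSpace E] [IsTopologicalAddGroup E] [ContinuousSMul ℝ E] [T1Space E]
    [CompactSpace E] : Subsingleton E := by
  refine subsingleton_of_forall_eq 0 fun y => ?_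
  have hb : Bornology.IsVonNBounded ℝ (univ : Set E) := isCompact_univ.isVonNBounded ℝ
  have h := hb.smul_tendsto_zero (𝕜 := ℝ) (ε := fun n : ℕ => (1 : ℝ) / (n + 1))
    (x := fun n : ℕ => ((n : ℝ) + 1) • y) (.of_forall fun _ => mem_univ _)
    tendsto_one_div_add_atTop_nhds_zero_nat
  have h2 : ∀ n : ℕ, ((1 : ℝ) / (n + 1)) • (((n : ℝ) + 1) • y) = y := fun n => by
    rw [smul_smul, one_div_mul_cancel (by positivity), one_smul]
  refine tendsto_nhds_unique_of_eventuallyEq (tendsto_const_nhds (f := (atTop : Filter ℕ))) h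
    (.of_forall fun n => (h2 n).symm)

theorem theorem1p9 {X Y : Type*}
    [TopologicalSpace X] [TopologicalSpace.MetrizableSpace X] [SigmaCompactSpace X]
    [SuslinSpace X] [PerfectSpace X]
    [AddCommGroup Y] [Module ℝ Y] [TopologicalSpace Y] [FrechetSpace Y]
    (T : Set (X × Y)) :
    (CompactSpace Y →
      ((∃ f : X → Y, IsBaire 2 f ∧ graphAccSet f = T) ↔
        IsClosed T ∧ ∀ x : X, (T ∩ ({x} ×ˢ univ)).Nonempty)) ∧
    (SigmaCompactSpace Y → ¬ CompactSpace Y →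
      ((∃ f : X → Y, IsBaire 2 f ∧ graphAccSet f = T) ↔
        IsClosed T ∧ ∃ D : Set X, D.Countable ∧
          ∀ x ∈ Dᶜ, (T ∩ ({x} ×ˢ univ)).Nonempty)) := by
  have hfibre : ∀ x : X, (T ∩ ({x} ×ˢ univ)).Nonempty ↔ ∃ y, (x, y) ∈ T := fun x => by
    constructor
    · rintro ⟨⟨_, y⟩, h, rfl, -⟩
      exact ⟨y, h⟩
    · rintro ⟨y, h⟩
      exact ⟨(x, y), h, rfl, mem_univ _⟩
  simp only [hfibre]
  have := FrechetSpace.isCompletelyMetrizableSpace Y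
  let := TopologicalSpace.metrizableSpaceMetric X
  let := TopologicalSpace.metrizableSpaceMetric Y
  constructor
  · intro _
    have := subsingleton_of_compactSpace Y
    have hacc : ∀ f : X → Y, graphAccSet f = univ := fun f => by
      refine eq_univ_of_forall fun p => mem_graphAccSet_of_forall (x := p.1) (y := p.2)
        fun U hU V hV => ?_
      obtain ⟨z, hzU, hzx⟩ := (inter_mem (mem_nhdsWithin_of_mem_nhds hU)
        (self_mem_nhdsWithin (a := p.1) (s := {p.1}ᶜ)) |> (𝓝[≠] p.1).nonempty_of_mem)
      exact ⟨z, hzU, hzx, Subsingleton.elim p.2 (f z) ▸ mem_of_mem_nhds hV⟩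
    constructor
    · rintro ⟨f, -, rfl⟩
      exact ⟨isClosed_graphAccSet f, fun x => ⟨f x, hacc f ▸ mem_univ _⟩⟩
    · rintro ⟨-, hne⟩
      refine ⟨fun _ => 0, isBaire_const 2 0, (hacc _).trans (eq_univ_of_forall ?_).symm⟩
      rintro ⟨x, y⟩
      obtain ⟨y', hy'⟩ := hne x
      rwa [Subsingleton.elim y y']
  · intro _ hnc
    have := locallyCompactSpace_of_sigmaCompactSpace_of_baireSpace Y
    have := not_compactSpace_iff.1 hnc
    constructor
    · rintro ⟨f, -, rfl⟩
      refine ⟨isClosed_graphAccSet f, _, countable_setOf_fibre_graphAccSet_eq_empty f,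
        fun x hx => ?_⟩
      by_contra! h
      exact hx h
    · rintro ⟨hT, D, hD, hne⟩
      refine exists_isBaire_two_graphAccSet_eq hT (hD.mono fun x hx => ?_)
      by_contra hxD
      obtain ⟨y, hy⟩ := hne x hxD
      exact hx y hy
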